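/- Let $F$ be a field, $K\supseteq F$ a field, and let $\nu\colon K\to\Gamma\cup\{\infty\}$ be a valuation with values in a totally ordered abelian group $\Gamma$, trivial on $F$ (that is, $\nu(a)=0$ for $0\ne a\in F$) and whose values are not bounded below in $\Gamma$ (if $\Gamma\subseteq\mathbb R$, or if $\Gamma$ is the value group of $\nu$, this just says that $\nu$ is nontrivial). For $0\le m\in\Gamma$ put $W_m=\{k\in K:\nu(k)\ge -m\}$, an $F$-subspace of $K$ containing $F$. Let $R=F[x]*_FK$ be the free product of $F$-algebras, and for an $F$-subspace $W\subseteq K$ let $RxWxR$ be the two-sided ideal of $R$ generated by all $xwx$, $w\in W$. Put $P_m=RxW_mxR$. A two-sided ideal $P\neq R$ is prime if $aRb\subseteq P$ implies $a\in P$ or $b\in P$; a two-sided ideal $I$ is semiprime if $aRa\subseteq I$ implies $a\in I$; the radical $\sqrt I$ is the intersection of all prime ideals containing $I$. Given an $F$-algebra $B$ with a decomposition $B=F\oplus B_0$ of vector spaces, a subspace $W\subseteq B$ containing $F$ is restricted if for every nonzero finite dimensional subspace $V\subseteq B$ there are $b,b'\in B$ with $Vb\subseteq B_0$, $Vb\not\subseteq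 W$, and $b'V\subseteq B_0$, $b'V\not\subseteq W$. Then: 1. For every $m\ge 0$, $W_m$ is a restricted subspace of $K$, for every vector space decomposition $K=F\oplus K_0$. 2. For every $m\ge 0$, the ideal $P_m$ of $R$ is prime; and $P_m\subseteq P_{m'}$ whenever $m\le m'$. 3. For every cofinal set $S$ of nonnegative elements of $\Gamma$ (for example $S=\mathbb N$ when $\Gamma=\mathbb Z$ or $\Gamma=\mathbb R$), $\bigcup_{m\in S}W_m=K$ and $\bigcup_{m\in S}P_m=RxKxR$. Moreover $RxKxR=(RxR)^2$. 4. The ideal $(RxR)^2$ is not semiprime. 5. $\sqrt{(RxR)^2}=RxR$, and $RxR$ is a maximal two-sided ideal of $R$, with $R/RxR\cong K$ as $F$-algebras, by an isomorphism that sends the class of each $k\in K$ to $k$. -/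

import Mathlib

open Polynomial

universe u v w

/-! ### The free product of two algebras -/

/-- The family consisting of the two algebras `A` and `B` (lifted to a common universe). -/
def PairFamily (A : Type v) (B : Type w) : Bool → Type (max v w)
  | false => ULift.{w} A
  | true => ULift.{v} B

noncomputable instance PairFamily.instRing (A : Type v) (B : Type w) [Ring A] [Ring B] :
    ∀ i, Ring (PairFamily A B i)
  | false => inferInstanceAs (Ring (ULift.{w} A))
  | true => inferInstanceAs (Ring (ULift.{v} B))

noncomputable instance PairFamily.instAlgebra (F : Type u) (A : Type v) (B : Type w)
    [CommRing F] [Ring A] [Ring B] [Algebra F A] [Algebra F B] :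
    ∀ i, Algebra F (PairFamily A B i)
  | false => inferInstanceAs (Algebra F (ULift.{w} A))
  | true => inferInstanceAs (Algebra F (ULift.{v} B))

/-- The free product `A *_F B` (the coproduct of `A` and `B` as unital associative
`F`-algebras). -/
abbrev FreeProd (F : Type u) (A : Type v) (B : Type w)
    [CommRing F] [Ring A] [Ring B] [Algebra F A] [Algebra F B] : Type (max u v w) :=
  LinearAlgebra.FreeProduct F (PairFamily A B)

namespace FreeProd

variable (F : Type u) (A : Type v) (B : Type w)
  [CommRing F] [Ring A] [Ring B] [Algebra F A] [Algebra F B]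

/-- The canonical map `A → A *_F B`. -/
noncomputable def inl : A →ₐ[F] FreeProd F A B :=
  (LinearAlgebra.FreeProduct.ι F (PairFamily A B) false).comp
    ((ULift.algEquiv (R := F) (A := A)).symm.toAlgHom : A →ₐ[F] ULift.{w} A)

/-- The canonical map `B → A *_F B`. -/
noncomputable def inr : B →ₐ[F] FreeProd F A B :=
  (LinearAlgebra.FreeProduct.ι F (PairFamily A B) true).comp
    ((ULift.algEquiv (R := F) (A := B)).symm.toAlgHom : B →ₐ[F] ULift.{v} B)

end FreeProd

/-! ### Two-sided ideals of a noncommutative ring -/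

namespace TwoSidedIdeal

variable {R : Type u} [Ring R]

/-- A prime ideal of a (not necessarily commutative) ring: a proper two-sided ideal `P` such that
`a R b ⊆ P` implies `a ∈ P` or `b ∈ P`. -/
def IsPrimeIdeal (P : TwoSidedIdeal R) : Prop :=
  P ≠ ⊤ ∧ ∀ a b : R, (∀ r : R, a * r * b ∈ P) → a ∈ P ∨ b ∈ P

/-- A semiprime ideal: `a R a ⊆ I` implies `a ∈ I`. -/
def IsSemiprimeIdeal (I : TwoSidedIdeal R) : Prop :=
  ∀ a : R, (∀ r : R, a * r * a ∈ I) → a ∈ I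

/-- The product `I J`: the ideal generated by the products `a * b` with `a ∈ I`, `b ∈ J`. -/
def idealMul (I J : TwoSidedIdeal R) : TwoSidedIdeal R :=
  span {z | ∃ a ∈ I, ∃ b ∈ J, z = a * b}

/-- The (prime) radical of an ideal: the intersection of all the prime ideals containing it. -/
def primeRadical (I : TwoSidedIdeal R) : TwoSidedIdeal R :=
  sInf {P | P.IsPrimeIdeal ∧ I ≤ P}

end TwoSidedIdeal

/-! ### Restricted subspaces -/

/-- Let `B` be an `F`-algebra with a vector space decomposition `B = F ⊕ B₀`. A subspace `W`
containing `F` is *restricted* if for every nonzero finite dimensional subspace `V` of `B` there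
are `b` with `V b ⊆ B₀`, `V b ⊄ W`, and `b'` with `b' V ⊆ B₀`, `b' V ⊄ W`. -/
structure IsRestrictedSubspace {F : Type u} {B : Type v} [Field F] [Ring B] [Algebra F B]
    (B₀ W : Submodule F B) : Prop where
  one_le : (1 : Submodule F B) ≤ W
  right : ∀ V : Submodule F B, V ≠ ⊥ → FiniteDimensional F V →
    ∃ b : B, (∀ v ∈ V, v * b ∈ B₀) ∧ ∃ v ∈ V, v * b ∉ W
  left : ∀ V : Submodule F B, V ≠ ⊥ → FiniteDimensional F V →
    ∃ b : B, (∀ v ∈ V, b * v ∈ B₀) ∧ ∃ v ∈ V, b * v ∉ W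

/-! ### The ideals attached to a valued field -/

section Valued

variable {F : Type u} {K : Type v} {Γ : Type w} [Field F] [Field K] [Algebra F K]
  [AddCommGroup Γ] [LinearOrder Γ] [IsOrderedAddMonoid Γ]

/-- The `F`-subspace `W_γ = {k : ν(k) ≥ -γ}` of a field `K` with a valuation `ν` that is trivial
on the field of scalars `F`. -/
def valuationSubspace (ν : AddValuation K (WithTop Γ))
    (hF : ∀ a : F, a ≠ 0 → ν (algebraMap F K a) = 0) (γ : Γ) : Submodule F K where
  carrier := {k | ((-γ : Γ) : WithTop Γ) ≤ ν k}
  zero_mem' := by simp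
  add_mem' := fun {a b} ha hb => ν.map_le_add ha hb
  smul_mem' := fun c k hk => by
    by_cases hc : c = 0
    · simp [hc]
    · simpa [Algebra.smul_def, hF c hc] using hk

variable (F K)

/-- The free product `F[x] *_F K`. -/
abbrev PolyFreeProd : Type (max u v) := FreeProd F F[X] K

/-- The element `x` of `F[x] *_F K`. -/
noncomputable def xElem : PolyFreeProd F K := FreeProd.inl F F[X] K X

/-- The inclusion of `K` in `F[x] *_F K`. -/
noncomputable def ofK : K →ₐ[F] PolyFreeProd F K := FreeProd.inr F F[X] K

/-- The ideal `R x R` of `R = F[x] *_F K`. -/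
noncomputable def xIdeal : TwoSidedIdeal (PolyFreeProd F K) :=
  TwoSidedIdeal.span {xElem F K}

variable {F K}

/-- The ideal `R x W x R` of `R = F[x] *_F K`, generated by the elements `x w x` with `w ∈ W`. -/
noncomputable def xWxIdeal (W : Submodule F K) : TwoSidedIdeal (PolyFreeProd F K) :=
  TwoSidedIdeal.span {z | ∃ w ∈ W, z = xElem F K * ofK F K w * xElem F K}

end Valued

/-!
The ring `R = F[x] *_F K` is spanned by the words `k₀ x k₁ x ⋯ x kₙ`, and modulo `R x W x R` the
inner letters `k₁, …, kₙ₋₁` only matter modulo `W`. So the quotient is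
`K ⊕ ⨁ₙ K ⊗ (K / W)^{⊗ n} ⊗ K`, and the primeness of `R x W x R` is a matter of linear algebra: it
holds for every proper subspace `W` of the field `K`.

To make this precise without normal forms, `R` acts on the functions from words over `β` to `K`,
where `β` indexes a basis of `K / W` with coordinate functionals `c i`. Elements of `K` act by
scalar multiplication, and `x` acts by `(x f) [] = 0` and `(x f) (i :: m) = c i (f m)`
(`wordRep`). As `x f` has values in `F`, each `x w x` with `w ∈ W` acts as zero. Conversely, if
`W ≠ K`, an element `a` that kills all functions supported at the empty word lies in `R x W x R`
(`mem_xWxIdeal_of_wordRep_eq_zero`): lifts `q i` of the basis give elements `x q_{i₁} x ⋯ x`,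
which together with `K` span `R` modulo `R x W x R` as a `K`-bimodule (`exists_wordSum_sub_mem`),
and their coefficients in `K ⊗ K` can be read off from the action, because any nonzero element of
the field `K` can be multiplied out of `W` (`eq_zero_of_tensorEval_eq_zero`).

The action commutes with right convolution by functions `t` with values in `F`
(`wordRep_wordConv`), and convolution has no zero divisors (`wordConv_ne_zero`). Let `δ` be the
function with value `1` at the empty word and `0` elsewhere. If `a` and `b` are not in
`R x W x R`, choose `k₁` and `k₂` in `K` with `a k₁ δ ≠ 0` and `b k₂ δ ≠ 0`, and then `k` such
that `t = x k b k₂ δ` is nonzero. Then `a k₁ x k b k₂ δ` is the convolution of `a k₁ δ` and `t`,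
and so it is not zero (`isPrimeIdeal_xWxIdeal`).

The subspace `W_γ` is proper since `ν` is not bounded below, and restricted since a subspace of
`K` of finite codimension contains elements of arbitrarily small value
(`exists_mul_mem_and_notMem_valuationSubspace`). The statements on `R x R` come from the
retraction `R → K` that sends `x` to `0`, and from `x R x ⊆ R x K x R`
(`xElem_mul_mul_xElem_mem`). Finally `x ∉ R x K x R`, because `R x K x R` is the union of the
ideals `R x W_γ x R`, none of which contains `x`.
-/

/-! ### The universal property of `F[x] *_F K` -/

namespace FreeProd

variable {F : Type u} {A : Type v} {B : Type w}
  [CommRing F] [Ring A] [Ring B] [Algebra F A] [Algebra F B]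

/-- The algebra map out of `A *_F B` determined by its restrictions to `A` and `B`. -/
noncomputable def lift {C : Type*} [Ring C] [Algebra F C] (f : A →ₐ[F] C) (g : B →ₐ[F] C) :
    FreeProd F A B →ₐ[F] C :=
  LinearAlgebra.FreeProduct.lift F (PairFamily A B) fun {i} =>
    match i with
    | false => f.comp (ULift.algEquiv (R := F) (A := A)).toAlgHom
    | true => g.comp (ULift.algEquiv (R := F) (A := B)).toAlgHom

theorem lift_inl {C : Type*} [Ring C] [Algebra F C] (f : A →ₐ[F] C) (g : B →ₐ[F] C) (a : A) :
    lift f g (inl F A B a) = f a :=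
  DFunLike.congr_fun (LinearAlgebra.FreeProduct.lift_comp_ι F (PairFamily A B)
    (fun {i} => match i with
      | false => f.comp (ULift.algEquiv (R := F) (A := A)).toAlgHom
      | true => g.comp (ULift.algEquiv (R := F) (A := B)).toAlgHom) (i := false)) (ULift.up a)

theorem lift_inr {C : Type*} [Ring C] [Algebra F C] (f : A →ₐ[F] C) (g : B →ₐ[F] C) (b : B) :
    lift f g (inr F A B b) = g b :=
  DFunLike.congr_fun (LinearAlgebra.FreeProduct.lift_comp_ι F (PairFamily A B)
    (fun {i} => match i with
      | false => f.comp (ULift.algEquiv (R := F) (A := A)).toAlgHom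
      | true => g.comp (ULift.algEquiv (R := F) (A := B)).toAlgHom) (i := true)) (ULift.up b)

theorem hom_ext {C : Type*} [Ring C] [Algebra F C] {f g : FreeProd F A B →ₐ[F] C}
    (hl : ∀ a, f (inl F A B a) = g (inl F A B a)) (hr : ∀ b, f (inr F A B b) = g (inr F A B b)) :
    f = g := by
  apply (LinearAlgebra.FreeProduct.lift F (PairFamily A B)).symm.injective
  funext i
  refine AlgHom.ext fun a => ?_
  cases i with
  | false => exact hl a.down
  | true => exact hr a.down

end FreeProd

section PolyFreeProd

variable {F : Type u} {K : Type v} [Field F] [Field K] [Algebra F K]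

/-- The algebra map out of `F[x] *_F K` determined by the image of `x` and its restriction to
`K`. -/
noncomputable def polyLift {C : Type*} [Ring C] [Algebra F C] (y : C) (g : K →ₐ[F] C) :
    PolyFreeProd F K →ₐ[F] C :=
  FreeProd.lift (aeval y) g

@[simp]
theorem polyLift_xElem {C : Type*} [Ring C] [Algebra F C] (y : C) (g : K →ₐ[F] C) :
    polyLift y g (xElem F K) = y := by
  rw [polyLift, xElem, FreeProd.lift_inl, aeval_X]

@[simp]
theorem polyLift_ofK {C : Type*} [Ring C] [Algebra F C] (y : C) (g : K →ₐ[F] C) (k : K) :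
    polyLift y g (ofK F K k) = g k :=
  FreeProd.lift_inr _ _ _

theorem eq_top_of_xElem_mem_of_ofK_mem (S : Subalgebra F (PolyFreeProd F K))
    (hx : xElem F K ∈ S) (hK : ∀ k, ofK F K k ∈ S) : S = ⊤ := by
  have key : S.val.comp (polyLift (⟨xElem F K, hx⟩ : S) ((ofK F K).codRestrict S hK)) =
      AlgHom.id F (PolyFreeProd F K) := by
    refine FreeProd.hom_ext (fun p => ?_) fun k => ?_
    · have : (S.val.comp (polyLift (⟨xElem F K, hx⟩ : S) ((ofK F K).codRestrict S hK))).comp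
          (FreeProd.inl F F[X] K) = FreeProd.inl F F[X] K := by
        apply Polynomial.algHom_ext
        exact congrArg S.val (polyLift_xElem (C := S) _ _)
      exact DFunLike.congr_fun this p
    · exact congrArg S.val (polyLift_ofK (C := S) _ _ k)
  refine top_unique fun a _ => ?_
  have := DFunLike.congr_fun key a
  rw [AlgHom.id_apply] at this
  rw [← this]
  exact Subtype.prop _

theorem ofK_algebraMap (r : F) :
    ofK F K (algebraMap F K r) = algebraMap F (PolyFreeProd F K) r :=
  (ofK F K).commutes r

/-- Every element of `F[x] *_F K` is obtained from `1` by additions and left multiplications by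
`x` and by elements of `K`. -/
theorem PolyFreeProd.left_induction {p : PolyFreeProd F K → Prop} (one : p 1)
    (add : ∀ a b, p a → p b → p (a + b)) (x_mul : ∀ a, p a → p (xElem F K * a))
    (ofK_mul : ∀ k a, p a → p (ofK F K k * a)) (a : PolyFreeProd F K) : p a := by
  -- the elements whose left multiplication preserves `p` form a subalgebra
  let S : Subalgebra F (PolyFreeProd F K) :=
    { carrier := {r | ∀ a, p a → p (r * a)}
      mul_mem' := fun {r s} hr hs a ha => by rw [mul_assoc]; exact hr _ (hs _ ha)
      add_mem' := fun {r s} hr hs a ha => by rw [add_mul]; exact add _ _ (hr _ ha) (hs _ ha)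
      algebraMap_mem' := fun r a ha => by rw [← ofK_algebraMap]; exact ofK_mul _ _ ha }
  have hS : S = ⊤ := eq_top_of_xElem_mem_of_ofK_mem S x_mul ofK_mul
  have ha : a ∈ S := hS ▸ Algebra.mem_top
  simpa using ha 1 one

/-! ### The action of `F[x] *_F K` on functions on words -/

variable {β : Type*}

/-- The operator on functions on words over `β` by which `x` acts, for a family `c` of linear
functionals on `K`: the value of `f` at `m` is replaced by the values `c i (f m)` at the words
`i :: m`, and the value at the empty word is `0`. -/
def wordShift (c : β → K →ₗ[F] F) : Module.End F (List β → K) where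
  toFun f
    | [] => 0
    | i :: m => algebraMap F K (c i (f m))
  map_add' f g := by
    funext l
    cases l <;> simp
  map_smul' r f := by
    funext l
    cases l with
    | nil => simp
    | cons i m =>
      change algebraMap F K (c i (r • f m)) = r • algebraMap F K (c i (f m))
      rw [map_smul, smul_eq_mul, map_mul, Algebra.smul_def]

@[simp] theorem wordShift_nil (c : β → K →ₗ[F] F) (f : List β → K) : wordShift c f [] = 0 := rfl

@[simp] theorem wordShift_cons (c : β → K →ₗ[F] F) (f : List β → K) (i : β) (m : List β) :
    wordShift c f (i :: m) = algebraMap F K (c i (f m)) := rfl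

/-- The representation of `F[x] *_F K` on the functions from words over `β` to `K` in which `K` acts
by scalar multiplication and `x` acts by `wordShift c`. -/
noncomputable def wordRep (c : β → K →ₗ[F] F) :
    PolyFreeProd F K →ₐ[F] Module.End F (List β → K) :=
  polyLift (wordShift c) (Algebra.lsmul F F (List β → K))

@[simp] theorem wordRep_xElem (c : β → K →ₗ[F] F) : wordRep c (xElem F K) = wordShift c :=
  polyLift_xElem _ _

@[simp] theorem wordRep_ofK (c : β → K →ₗ[F] F) (k : K) (f : List β → K) :
    wordRep c (ofK F K k) f = k • f := by
  rw [wordRep, polyLift_ofK]; rfl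

/-- The ideal `R x W x R` acts as zero if the functionals vanish on `W`. -/
theorem wordRep_eq_zero_of_mem {c : β → K →ₗ[F] F} {W : Submodule F K}
    (hc : ∀ i, ∀ k ∈ W, c i k = 0) {a : PolyFreeProd F K} (ha : a ∈ xWxIdeal W) :
    wordRep c a = 0 := by
  have : xWxIdeal W ≤ TwoSidedIdeal.ker (wordRep c).toRingHom := by
    refine TwoSidedIdeal.span_le.2 ?_
    rintro _ ⟨k, hk, rfl⟩
    rw [SetLike.mem_coe, TwoSidedIdeal.mem_ker]
    refine LinearMap.ext fun f => ?_
    funext l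
    change wordRep c (xElem F K * ofK F K k * xElem F K) f l = 0
    rw [map_mul, map_mul, Module.End.mul_apply, Module.End.mul_apply, wordRep_xElem, wordRep_ofK]
    match l with
    | [] => rfl
    | [i] => simp
    | i :: j :: m =>
      have : c i (k * algebraMap F K (c j (f m))) = 0 := by
        rw [mul_comm, ← Algebra.smul_def, map_smul, hc i k hk, smul_zero]
      simp [this]
  exact (TwoSidedIdeal.mem_ker _).1 (this ha)

/-! ### Convolution of functions on words -/

/-- The function on words with value `s` at the empty word, and `0` elsewhere. -/
def emptyWordSingle (s : K) : List β → K
  | [] => s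
  | _ :: _ => 0

theorem smul_emptyWordSingle (k s : K) :
    k • (emptyWordSingle s : List β → K) = emptyWordSingle (k * s) := by
  funext l
  cases l <;> simp [emptyWordSingle]

/-- The convolution product of two functions on words: its value at `m` is the sum of the products
`h m₁ * t m₂` over all the ways to write `m` as `m₁ ++ m₂`. -/
def wordConv (h t : List β → K) : List β → K
  | [] => h [] * t []
  | i :: m => h [] * t (i :: m) + wordConv (fun l => h (i :: l)) t m

theorem wordConv_zero_left (t : List β → K) (l : List β) :
    wordConv (fun _ => 0) t l = 0 := by
  induction l with
  | nil => simp [wordConv]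
  | cons i m ih => simp [wordConv, ih]

theorem wordConv_emptyWordSingle (k : K) (t : List β → K) :
    wordConv (emptyWordSingle k) t = k • t := by
  funext l
  cases l with
  | nil => rfl
  | cons i m =>
    change k * t (i :: m) + wordConv (fun _ => 0) t m = _
    rw [wordConv_zero_left, add_zero]; rfl

theorem wordConv_add_left (h h' t : List β → K) :
    wordConv (h + h') t = wordConv h t + wordConv h' t := by
  funext l
  induction l generalizing h h' with
  | nil => simp [wordConv, add_mul]
  | cons i m ih =>
    change (h [] + h' []) * t (i :: m) +
      wordConv ((fun l => h (i :: l)) + fun l => h' (i :: l)) t m = _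
    rw [ih, Pi.add_apply, Pi.add_apply]
    simp only [wordConv]
    ring

theorem wordConv_smul_left (k : K) (h t : List β → K) :
    wordConv (k • h) t = k • wordConv h t := by
  funext l
  induction l generalizing h with
  | nil => simp [wordConv, mul_assoc]
  | cons i m ih =>
    have := ih (fun l => h (i :: l))
    change k * h [] * t (i :: m) + wordConv (k • fun l => h (i :: l)) t m = _
    rw [this]
    simp [wordConv]; ring

/-- A functional of a convolution by a function with values in `F` is the convolution of the
functional. -/
theorem wordConv_functional (φ : K →ₗ[F] F) (h : List β → K) (t : List β → F) (l : List β) :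
    algebraMap F K (φ (wordConv h (fun m => algebraMap F K (t m)) l)) =
      wordConv (fun m => algebraMap F K (φ (h m))) (fun m => algebraMap F K (t m)) l := by
  have hφ : ∀ (a : K) (r : F), φ (a * algebraMap F K r) = φ a * r := fun a r => by
    rw [mul_comm, ← Algebra.smul_def, map_smul, smul_eq_mul, mul_comm]
  induction l generalizing h with
  | nil => simp [wordConv, hφ]
  | cons i m ih => simp [wordConv, hφ, ih]

/-- The action of `F[x] *_F K` on functions on words commutes with convolution on the right by
functions with values in `F`. -/
theorem wordRep_wordConv (c : β → K →ₗ[F] F) (a : PolyFreeProd F K) (h : List β → K)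
    (t : List β → F) :
    wordRep c a (wordConv h fun m => algebraMap F K (t m)) =
      wordConv (wordRep c a h) fun m => algebraMap F K (t m) := by
  induction a using PolyFreeProd.left_induction with
  | one => simp
  | add a b ha hb => simp only [map_add, LinearMap.add_apply, ha, hb, wordConv_add_left]
  | x_mul a ha =>
    rw [map_mul, Module.End.mul_apply, Module.End.mul_apply, ha, wordRep_xElem]
    funext l
    cases l with
    | nil => simp [wordConv]
    | cons i m => simp [wordConv, wordConv_functional]
  | ofK_mul k a ha =>
    rw [map_mul, Module.End.mul_apply, Module.End.mul_apply, ha, wordRep_ofK, wordRep_ofK,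
      wordConv_smul_left]

/-- If `t` vanishes on all words shorter than `m₂` and `h` on all words shorter than `m₁`, then only
one splitting of `m₁ ++ m₂` contributes to the convolution. -/
theorem wordConv_append (h t : List β → K) (m₁ m₂ : List β)
    (hh : ∀ m, m.length < m₁.length → h m = 0) (ht : ∀ m, m.length < m₂.length → t m = 0) :
    wordConv h t (m₁ ++ m₂) = h m₁ * t m₂ := by
  induction m₁ generalizing h with
  | nil =>
    have short : ∀ (m : List β) (h : List β → K), m.length < m₂.length →
        wordConv h t m = 0 := by
      intro m
      induction m with
      | nil => intro h hm; simp [wordConv, ht _ hm]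
      | cons i m ih =>
        intro h hm
        rw [wordConv, ht _ hm, ih _ ((Nat.lt_succ_self _).trans hm), mul_zero, add_zero]
    cases m₂ with
    | nil => rfl
    | cons i m => simp [wordConv, short m _ (Nat.lt_succ_self _)]
  | cons i m ih =>
    rw [List.cons_append, wordConv, hh [] (Nat.succ_pos _), zero_mul, zero_add]
    exact ih _ fun l hl => hh _ (Nat.succ_lt_succ hl)

theorem wordConv_ne_zero {h t : List β → K} (hh : h ≠ 0) (ht : t ≠ 0) : wordConv h t ≠ 0 := by
  have shortest : ∀ f : List β → K, f ≠ 0 →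
      ∃ m, f m ≠ 0 ∧ ∀ l, l.length < m.length → f l = 0 := by
    intro f hf
    obtain ⟨m, hm⟩ := Function.ne_iff.1 hf
    obtain ⟨m₀, h₀, hmin⟩ := WellFounded.has_min (measure (List.length (α := β))).wf
      {m | f m ≠ 0} ⟨m, hm⟩
    exact ⟨m₀, h₀, fun l hl => not_not.1 fun hl' => hmin l hl' hl⟩
  obtain ⟨m₁, h₁, hs₁⟩ := shortest h hh
  obtain ⟨m₂, h₂, hs₂⟩ := shortest t ht
  intro h0
  have := wordConv_append h t m₁ m₂ hs₁ hs₂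
  rw [h0] at this
  exact mul_ne_zero h₁ h₂ this.symm

end PolyFreeProd

open scoped TensorProduct

/-! ### Generators modulo `R x W x R` -/

section Faithful

variable {F : Type u} {K : Type v} [Field F] [Field K] [Algebra F K] {β : Type*}

/-- A basis of `K / W`: functionals `c` that cut out `W`, and a family `q` in `K` dual to `c` which
spans `K` modulo `W`. -/
structure IsCoordSystem (W : Submodule F K) (c : β → K →ₗ[F] F) (q : β → K) : Prop where
  mem_iff : ∀ k, k ∈ W ↔ ∀ i, c i k = 0
  apply_self : ∀ i, c i (q i) = 1
  apply_ne : ∀ i j, i ≠ j → c i (q j) = 0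
  span : W ⊔ Submodule.span F (Set.range q) = ⊤

theorem exists_isCoordSystem (W : Submodule F K) :
    ∃ (β : Type v) (c : β → K →ₗ[F] F) (q : β → K), IsCoordSystem W c q := by
  let b := Module.Basis.ofVectorSpace F (K ⧸ W)
  choose q hq using fun i => W.mkQ_surjective (b i)
  refine ⟨_, fun i => b.coord i ∘ₗ W.mkQ, q, fun k => ?_, fun i => ?_, fun i j hij => ?_, ?_⟩
  · rw [← Submodule.Quotient.mk_eq_zero, ← Submodule.mkQ_apply, ← b.forall_coord_eq_zero_iff]
    rfl
  · simp [hq]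
  · simp only [LinearMap.comp_apply, hq, b.coord_apply, b.repr_self]
    exact Finsupp.single_eq_of_ne hij
  · rw [← Submodule.map_mkQ_eq_top, Submodule.map_span, ← Set.range_comp]
    have : W.mkQ ∘ q = b := funext hq
    rw [this, b.span_eq]

/-- The element `x q_{i₁} x q_{i₂} x ⋯ q_{iₙ} x` attached to a word `i₁ ⋯ iₙ`. -/
noncomputable def wordElem (q : β → K) : List β → PolyFreeProd F K
  | [] => xElem F K
  | i :: m => xElem F K * ofK F K (q i) * wordElem q m

theorem exists_wordElem_eq (q : β → K) (m : List β) :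
    ∃ r : PolyFreeProd F K, wordElem q m = xElem F K * r := by
  cases m with
  | nil => exact ⟨1, (mul_one _).symm⟩
  | cons i m => exact ⟨ofK F K (q i) * wordElem q m, mul_assoc _ _ _⟩

/-- The linear map sending `k ⊗ s`, placed at the word `m`, to `k * wordElem q m * s`. -/
noncomputable def wordSum (q : β → K) : (List β →₀ K ⊗[F] K) →ₗ[F] PolyFreeProd F K :=
  Finsupp.lsum F fun m => TensorProduct.lift
    ((LinearMap.mul F (PolyFreeProd F K)).compl₁₂
      (LinearMap.mulRight F (wordElem q m) ∘ₗ (ofK F K).toLinearMap) (ofK F K).toLinearMap)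

theorem wordSum_single_tmul (q : β → K) (m : List β) (k s : K) :
    wordSum q (Finsupp.single m (k ⊗ₜ[F] s)) = ofK F K k * wordElem q m * ofK F K s := by
  simp [wordSum]

/-- Modulo `R x W x R`, every element of `R` is the sum of an element of `K` and of a combination of
the elements `k * wordElem q m * s`. -/
theorem exists_wordSum_sub_mem {W : Submodule F K} {q : β → K}
    (hq : W ⊔ Submodule.span F (Set.range q) = ⊤) (a : PolyFreeProd F K) :
    ∃ k y, a - (ofK F K k + wordSum q y) ∈ xWxIdeal W := by
  have ofK_mul_wordSum : ∀ k y, ∃ y', ofK F K k * wordSum q y = wordSum q y' := by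
    intro k y
    induction y using Finsupp.induction_linear with
    | zero => exact ⟨0, by simp⟩
    | add y z hy hz =>
      obtain ⟨y', hy⟩ := hy
      obtain ⟨z', hz⟩ := hz
      exact ⟨y' + z', by rw [map_add, mul_add, hy, hz, map_add]⟩
    | single m t =>
      induction t using TensorProduct.induction_on with
      | zero => exact ⟨0, by simp⟩
      | add y z hy hz =>
        obtain ⟨y', hy⟩ := hy
        obtain ⟨z', hz⟩ := hz
        exact ⟨y' + z', by rw [Finsupp.single_add, map_add, mul_add, hy, hz, map_add]⟩
      | tmul k' s =>
        refine ⟨Finsupp.single m ((k * k') ⊗ₜ s), ?_⟩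
        rw [wordSum_single_tmul, wordSum_single_tmul, map_mul]
        simp only [mul_assoc]
  have x_mul_wordSum : ∀ y, ∃ y', xElem F K * wordSum q y - wordSum q y' ∈ xWxIdeal W := by
    intro y
    have step_add : ∀ a b : PolyFreeProd F K,
        (∃ y', xElem F K * a - wordSum q y' ∈ xWxIdeal W) →
        (∃ y', xElem F K * b - wordSum q y' ∈ xWxIdeal W) →
        ∃ y', xElem F K * (a + b) - wordSum q y' ∈ xWxIdeal W := by
      rintro a b ⟨y, hy⟩ ⟨z, hz⟩
      refine ⟨y + z, ?_⟩
      rw [mul_add, map_add, add_sub_add_comm]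
      exact TwoSidedIdeal.add_mem _ hy hz
    induction y using Finsupp.induction_linear with
    | zero => exact ⟨0, by simp⟩
    | add y z hy hz => rw [map_add]; exact step_add _ _ hy hz
    | single m t =>
      induction t using TensorProduct.induction_on with
      | zero => exact ⟨0, by simp⟩
      | add y z hy hz => rw [Finsupp.single_add, map_add]; exact step_add _ _ hy hz
      | tmul k s =>
        have hk : k ∈ W ⊔ Submodule.span F (Set.range q) := hq ▸ Submodule.mem_top
        obtain ⟨k₁, hk₁, k₂, hk₂, rfl⟩ := Submodule.mem_sup.1 hk
        rw [TensorProduct.add_tmul, Finsupp.single_add, map_add]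
        refine step_add _ _ ⟨0, ?_⟩ ?_
        -- the part of `k` in `W` contributes a multiple of `x k₁ x`, as `wordElem q m ∈ x R`
        · obtain ⟨r, hr⟩ := exists_wordElem_eq (F := F) q m
          rw [map_zero, sub_zero, wordSum_single_tmul, hr]
          have hmem : xElem F K * ofK F K k₁ * xElem F K ∈ xWxIdeal W :=
            TwoSidedIdeal.subset_span ⟨k₁, hk₁, rfl⟩
          have := TwoSidedIdeal.mul_mem_right _ _ (r * ofK F K s) hmem
          simpa only [mul_assoc] using this
        · clear hk
          induction hk₂ using Submodule.span_induction with
          | zero => exact ⟨0, by simp⟩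
          | add y z _ _ hy hz =>
            rw [TensorProduct.add_tmul, Finsupp.single_add, map_add]
            exact step_add _ _ hy hz
          | mem y hy =>
            obtain ⟨i, rfl⟩ := hy
            refine ⟨Finsupp.single (i :: m) (1 ⊗ₜ s), ?_⟩
            rw [wordSum_single_tmul, wordSum_single_tmul, map_one, one_mul, wordElem]
            simp [mul_assoc]
          | smul r y _ hy =>
            obtain ⟨y', hy⟩ := hy
            refine ⟨r • y', ?_⟩
            rw [← TensorProduct.smul_tmul', ← Finsupp.smul_single, map_smul, map_smul,
              mul_smul_comm, Algebra.smul_def, Algebra.smul_def, ← mul_sub]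
            exact TwoSidedIdeal.mul_mem_left _ _ _ hy
  induction a using PolyFreeProd.left_induction with
  | one => exact ⟨1, 0, by simp⟩
  | add a b ha hb =>
    obtain ⟨k, y, hy⟩ := ha
    obtain ⟨l, z, hz⟩ := hb
    refine ⟨k + l, y + z, ?_⟩
    have := TwoSidedIdeal.add_mem _ hy hz
    rwa [← add_sub_add_comm, add_add_add_comm, ← map_add, ← map_add] at this
  | x_mul a ha =>
    obtain ⟨k, y, hy⟩ := ha
    obtain ⟨z, hz⟩ := x_mul_wordSum y
    refine ⟨0, Finsupp.single [] (1 ⊗ₜ k) + z, ?_⟩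
    have := TwoSidedIdeal.add_mem _ (TwoSidedIdeal.mul_mem_left _ (xElem F K) _ hy) hz
    convert this using 1
    rw [map_add, wordSum_single_tmul, wordElem, map_zero, map_one, one_mul, mul_sub, mul_add]
    abel
  | ofK_mul l a ha =>
    obtain ⟨k, y, hy⟩ := ha
    obtain ⟨z, hz⟩ := ofK_mul_wordSum l y
    refine ⟨l * k, z, ?_⟩
    have := TwoSidedIdeal.mul_mem_left _ (ofK F K l) _ hy
    rwa [mul_sub, mul_add, hz, ← map_mul] at this

/-! ### The kernel of the action -/

theorem wordRep_wordElem_nil (c : β → K →ₗ[F] F) (q : β → K) (m : List β) (f : List β → K) :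
    wordRep c (wordElem q m) f [] = 0 := by
  obtain ⟨r, hr⟩ := exists_wordElem_eq (F := F) q m
  rw [hr, map_mul, Module.End.mul_apply, wordRep_xElem, wordShift_nil]

open Classical in
theorem wordRep_wordElem_append {W : Submodule F K} {c : β → K →ₗ[F] F} {q : β → K}
    (h : IsCoordSystem W c q) (m m' : List β) (j : β) (s : K) :
    wordRep c (wordElem q m) (emptyWordSingle s) (m' ++ [j]) =
      if m = m' then algebraMap F K (c j s) else 0 := by
  induction m generalizing m' with
  | nil =>
    rw [wordElem, wordRep_xElem]
    cases m' with
    | nil => simp [emptyWordSingle]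
    | cons i m' =>
      have : (emptyWordSingle s : List β → K) (m' ++ [j]) = 0 := by
        cases m' <;> rfl
      simp [this]
  | cons i m ih =>
    rw [wordElem, map_mul, map_mul, Module.End.mul_apply, Module.End.mul_apply, wordRep_xElem,
      wordRep_ofK]
    cases m' with
    | nil => simp [wordRep_wordElem_nil]
    | cons i' m' =>
      rw [List.cons_append, wordShift_cons, Pi.smul_apply, ih, smul_eq_mul]
      by_cases hm : m = m'
      · subst hm
        rw [if_pos rfl, mul_comm, ← Algebra.smul_def, map_smul]
        by_cases hi : i' = i
        · subst hi; simp [h.apply_self]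
        · simp [h.apply_ne _ _ hi, Ne.symm hi]
      · simp [hm]

/-- The map `a ⊗ s ↦ a * c (s * k)`, with `c` a functional on `K`. -/
noncomputable def tensorEval (c : K →ₗ[F] F) (k : K) : K ⊗[F] K →ₗ[F] K :=
  TensorProduct.lift ((LinearMap.mul F K).compl₁₂ LinearMap.id
    (Algebra.linearMap F K ∘ₗ c ∘ₗ LinearMap.mulRight F k))

@[simp] theorem tensorEval_tmul (c : K →ₗ[F] F) (k a s : K) :
    tensorEval c k (a ⊗ₜ[F] s) = a * algebraMap F K (c (s * k)) := by
  simp [tensorEval]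

/-- If the functionals `c` cut out a proper subspace of `K`, the maps `tensorEval (c j) k` separate
the elements of `K ⊗ K`: a nonzero coefficient `u` of a tensor can be moved out of `W` by a
multiplication. -/
theorem eq_zero_of_tensorEval_eq_zero {W : Submodule F K} (hW : W ≠ ⊤) {c : β → K →ₗ[F] F}
    (hc : ∀ k, k ∈ W ↔ ∀ i, c i k = 0) {y : K ⊗[F] K} (hy : ∀ j k, tensorEval (c j) k y = 0) :
    y = 0 := by
  classical
  let b := Module.Basis.ofVectorSpace F K
  let e := TensorProduct.equivFinsuppOfBasisLeft (N := K) b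
  have key : ∀ (j k) (z : K ⊗[F] K) (κ),
      b.coord κ (tensorEval (c j) k z) = c j (e z κ * k) := by
    intro j k z κ
    induction z using TensorProduct.induction_on with
    | zero => simp
    | add y z hy hz => simp only [map_add, Finsupp.add_apply, hy, hz, add_mul]
    | tmul a s =>
      rw [tensorEval_tmul, show e (a ⊗ₜ s) κ = b.coord κ a • s from
        TensorProduct.equivFinsuppOfBasisLeft_apply_tmul_apply _ _ _ _,
        smul_mul_assoc, map_smul, mul_comm, ← Algebra.smul_def, map_smul, smul_eq_mul,
        smul_eq_mul, mul_comm]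
  obtain ⟨k₀, hk₀⟩ : ∃ k, k ∉ W := by
    by_contra! h
    exact hW (Submodule.eq_top_iff'.2 h)
  rw [← e.map_eq_zero_iff]
  ext κ
  by_contra hne
  change e y κ ≠ 0 at hne
  refine hk₀ ((hc k₀).2 fun j => ?_)
  have := key j ((e y κ)⁻¹ * k₀) y κ
  rw [hy, map_zero, mul_inv_cancel_left₀ hne] at this
  exact this.symm

/-- An element that kills the functions supported at the empty word lies in `R x W x R`. So
`R x W x R` is the kernel of the action, by `wordRep_eq_zero_of_mem`. -/
theorem mem_xWxIdeal_of_wordRep_eq_zero {W : Submodule F K} (hW : W ≠ ⊤) {c : β → K →ₗ[F] F}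
    {q : β → K} (h : IsCoordSystem W c q) {a : PolyFreeProd F K}
    (ha : ∀ k, wordRep c a (emptyWordSingle k) = 0) : a ∈ xWxIdeal W := by
  obtain ⟨k₀, y, hy⟩ := exists_wordSum_sub_mem h.span a
  -- the values at the empty word detect `k₀`, and those at `m ++ [j]` the coefficient `y m`
  have sum_nil : ∀ z k, wordRep c (wordSum q z) (emptyWordSingle k) [] = 0 := by
    intro z k
    induction z using Finsupp.induction_linear with
    | zero => simp
    | add y z hy hz => rw [map_add, map_add, LinearMap.add_apply, Pi.add_apply, hy, hz, add_zero]
    | single m t =>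
      induction t using TensorProduct.induction_on with
      | zero => simp
      | add y z hy hz =>
        rw [Finsupp.single_add, map_add, map_add, LinearMap.add_apply, Pi.add_apply, hy, hz,
          add_zero]
      | tmul l s =>
        rw [wordSum_single_tmul, map_mul, map_mul, Module.End.mul_apply, Module.End.mul_apply,
          wordRep_ofK, wordRep_ofK, Pi.smul_apply, smul_emptyWordSingle, wordRep_wordElem_nil,
          smul_zero]
  have sum_append : ∀ z k m j, wordRep c (wordSum q z) (emptyWordSingle k) (m ++ [j]) =
      tensorEval (c j) k (z m) := by
    classical
    intro z k m j
    induction z using Finsupp.induction_linear with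
    | zero => simp
    | add y z hy hz =>
      rw [map_add, map_add, LinearMap.add_apply, Pi.add_apply, hy, hz, Finsupp.add_apply, map_add]
    | single m' t =>
      induction t using TensorProduct.induction_on with
      | zero => simp
      | add y z hy hz =>
        rw [Finsupp.single_add, map_add, map_add, LinearMap.add_apply, Pi.add_apply, hy, hz,
          Finsupp.add_apply, map_add]
      | tmul l s =>
        rw [wordSum_single_tmul, map_mul, map_mul, Module.End.mul_apply, Module.End.mul_apply,
          wordRep_ofK, wordRep_ofK, Pi.smul_apply, smul_emptyWordSingle,
          wordRep_wordElem_append h, Finsupp.single_apply]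
        split_ifs <;> simp
  have hzero : ∀ k l, wordRep c (ofK F K k₀ + wordSum q y) (emptyWordSingle k) l = 0 := by
    intro k l
    have := wordRep_eq_zero_of_mem (fun i k hk => (h.mem_iff k).1 hk i) hy
    rw [map_sub, sub_eq_zero] at this
    rw [← this, ha]; rfl
  have hk₀ : k₀ = 0 := by
    have := hzero 1 []
    simpa [sum_nil, emptyWordSingle] using this
  have hy₀ : y = 0 := by
    ext1 m
    refine eq_zero_of_tensorEval_eq_zero hW h.mem_iff fun j k => ?_
    have := hzero k (m ++ [j])
    simpa [hk₀, sum_append] using this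
  simpa [hk₀, hy₀] using hy

/-! ### Primeness -/

/-- The ideal `R x W x R` is prime for every proper subspace `W` of `K`. -/
theorem isPrimeIdeal_xWxIdeal {W : Submodule F K} (hW : W ≠ ⊤) :
    (xWxIdeal W).IsPrimeIdeal := by
  obtain ⟨β, c, q, h⟩ := exists_isCoordSystem W
  have hc : ∀ i, ∀ k ∈ W, c i k = 0 := fun i k hk => (h.mem_iff k).1 hk i
  refine ⟨fun htop => ?_, fun a b hab => ?_⟩
  · have h1 : wordRep c (1 : PolyFreeProd F K) = 0 :=
      wordRep_eq_zero_of_mem hc (htop ▸ TwoSidedIdeal.mem_top _)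
    rw [map_one] at h1
    have := congrFun (LinearMap.congr_fun h1 (emptyWordSingle 1)) []
    exact one_ne_zero this
  · by_contra! hne
    have exists_ne : ∀ a : PolyFreeProd F K, a ∉ xWxIdeal W →
        ∃ k, wordRep c a (emptyWordSingle k) ≠ 0 := fun a ha => by
      by_contra! h0
      exact ha (mem_xWxIdeal_of_wordRep_eq_zero hW h h0)
    obtain ⟨k₁, hk₁⟩ := exists_ne a hne.1
    obtain ⟨k₂, hk₂⟩ := exists_ne b hne.2
    obtain ⟨m, hm⟩ := Function.ne_iff.1 hk₂
    obtain ⟨k₀, hk₀⟩ : ∃ k, k ∉ W := by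
      by_contra! h
      exact hW (Submodule.eq_top_iff'.2 h)
    obtain ⟨i, hi⟩ : ∃ i, c i k₀ ≠ 0 := by
      by_contra! h0
      exact hk₀ ((h.mem_iff k₀).2 h0)
    set g := wordRep c b (emptyWordSingle k₂) with hg
    -- `x * k` maps the nonzero function `g` to a nonzero function with values in `F`
    let k := k₀ * (g m)⁻¹
    let t : List β → F
      | [] => 0
      | i :: l => c i (k * g l)
    have ht : wordShift c (k • g) = fun l => algebraMap F K (t l) := by
      funext l
      cases l with
      | nil => simp [t]
      | cons i l => rfl
    have ht0 : (fun l => algebraMap F K (t l)) ≠ 0 := by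
      refine Function.ne_iff.2 ⟨i :: m, ?_⟩
      change algebraMap F K (c i (k₀ * (g m)⁻¹ * g m)) ≠ 0
      rw [inv_mul_cancel_right₀ hm]
      simpa using hi
    have := wordRep_eq_zero_of_mem hc (hab (ofK F K k₁ * xElem F K * ofK F K k))
    refine wordConv_ne_zero hk₁ ht0 ?_
    rw [← wordRep_wordConv, wordConv_emptyWordSingle, ← ht, hg, ← wordRep_ofK c k,
      ← wordRep_ofK c k₁, ← wordRep_xElem]
    have := LinearMap.congr_fun this (emptyWordSingle k₂)
    simpa only [map_mul, Module.End.mul_apply, LinearMap.zero_apply] using this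

/-- The element `x` does not lie in `R x W x R` if `W` is a proper subspace of `K`. -/
theorem xElem_notMem_xWxIdeal {W : Submodule F K} (hW : W ≠ ⊤) :
    xElem F K ∉ xWxIdeal W := by
  intro hx
  obtain ⟨β, c, q, h⟩ := exists_isCoordSystem W
  have h0 := wordRep_eq_zero_of_mem (fun i k hk => (h.mem_iff k).1 hk i) hx
  refine hW (Submodule.eq_top_iff'.2 fun k => (h.mem_iff k).2 fun i => ?_)
  have := congrFun (LinearMap.congr_fun h0 (emptyWordSingle k)) [i]
  rw [wordRep_xElem] at this
  simpa [emptyWordSingle] using this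

end Faithful

/-! ### The ideals `R x R` and `R x K x R` -/

/-- The product of the ideals generated by `s` and `t` lies in `I` as soon as `s R t` does. -/
theorem TwoSidedIdeal.mul_mem_of_mem_span_of_mem_span {R : Type*} [Ring R] {s t : Set R}
    {I : TwoSidedIdeal R} (h : ∀ a ∈ s, ∀ b ∈ t, ∀ r, a * r * b ∈ I) {a b : R}
    (ha : a ∈ span s) (hb : b ∈ span t) : a * b ∈ I := by
  have gen_mul_mul : ∀ a ∈ s, ∀ b ∈ span t, ∀ r, a * r * b ∈ I := by
    intro a ha b hb
    induction hb using TwoSidedIdeal.span_induction with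
    | mem b hb => exact h a ha b hb
    | zero => intro r; simp [I.zero_mem]
    | add b c _ _ hb hc => intro r; rw [mul_add]; exact I.add_mem (hb r) (hc r)
    | neg b _ hb => intro r; rw [mul_neg]; exact I.neg_mem (hb r)
    | left_absorb s b _ hb => intro r; simpa only [mul_assoc] using hb (r * s)
    | right_absorb s b _ hb => intro r; rw [← mul_assoc]; exact I.mul_mem_right _ _ (hb r)
  induction ha using TwoSidedIdeal.span_induction generalizing b with
  | mem a ha => simpa using gen_mul_mul a ha b hb 1
  | zero => simp [I.zero_mem]
  | add a c _ _ ha hc => rw [add_mul]; exact I.add_mem (ha hb) (hc hb)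
  | neg a _ ha => rw [neg_mul]; exact I.neg_mem (ha hb)
  | left_absorb s a _ ha => rw [mul_assoc]; exact I.mul_mem_left _ _ (ha hb)
  | right_absorb s a _ ha => rw [mul_assoc]; exact ha (mul_mem_left _ _ _ hb)

section Ideals

variable {F : Type u} {K : Type v} [Field F] [Field K] [Algebra F K]

theorem xElem_mem_xIdeal : xElem F K ∈ xIdeal F K :=
  TwoSidedIdeal.subset_span rfl

theorem xWxIdeal_mono {W W' : Submodule F K} (h : W ≤ W') : xWxIdeal W ≤ xWxIdeal W' := by
  refine TwoSidedIdeal.span_mono ?_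
  rintro _ ⟨k, hk, rfl⟩
  exact ⟨k, h hk, rfl⟩

/-- The ideal `R x K x R` is the union of the ideals `R x W x R` with `W` in a directed family that
covers `K`. -/
theorem exists_mem_xWxIdeal_of_mem_top {ι : Type*} [Nonempty ι] {W : ι → Submodule F K}
    (hdir : Directed (· ≤ ·) W) (hW : ∀ k, ∃ i, k ∈ W i) {z : PolyFreeProd F K}
    (hz : z ∈ xWxIdeal (⊤ : Submodule F K)) : ∃ i, z ∈ xWxIdeal (W i) := by
  let I : TwoSidedIdeal (PolyFreeProd F K) := .mk' {z | ∃ i, z ∈ xWxIdeal (W i)}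
    ⟨Classical.arbitrary ι, TwoSidedIdeal.zero_mem _⟩
    (fun {y z} ⟨i, hi⟩ ⟨j, hj⟩ => by
      obtain ⟨l, hil, hjl⟩ := hdir i j
      exact ⟨l, TwoSidedIdeal.add_mem _ (xWxIdeal_mono hil hi) (xWxIdeal_mono hjl hj)⟩)
    (fun ⟨i, hi⟩ => ⟨i, TwoSidedIdeal.neg_mem _ hi⟩)
    (fun ⟨i, hi⟩ => ⟨i, TwoSidedIdeal.mul_mem_left _ _ _ hi⟩)
    (fun ⟨i, hi⟩ => ⟨i, TwoSidedIdeal.mul_mem_right _ _ _ hi⟩)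
  have : xWxIdeal (⊤ : Submodule F K) ≤ I := by
    refine TwoSidedIdeal.span_le.2 ?_
    rintro _ ⟨k, -, rfl⟩
    obtain ⟨i, hi⟩ := hW k
    rw [SetLike.mem_coe, TwoSidedIdeal.mem_mk']
    exact ⟨i, TwoSidedIdeal.subset_span ⟨k, hi, rfl⟩⟩
  have hzI := this hz
  rwa [TwoSidedIdeal.mem_mk'] at hzI

theorem exists_sub_ofK_mem_xIdeal (a : PolyFreeProd F K) :
    ∃ k, a - ofK F K k ∈ xIdeal F K := by
  induction a using PolyFreeProd.left_induction with
  | one => exact ⟨1, by simp⟩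
  | add a b ha hb =>
    obtain ⟨k, hk⟩ := ha
    obtain ⟨l, hl⟩ := hb
    exact ⟨k + l, by
      rw [map_add, add_sub_add_comm]; exact TwoSidedIdeal.add_mem _ hk hl⟩
  | x_mul a _ =>
    exact ⟨0, by
      rw [map_zero, sub_zero]; exact TwoSidedIdeal.mul_mem_right _ _ _ xElem_mem_xIdeal⟩
  | ofK_mul l a ha =>
    obtain ⟨k, hk⟩ := ha
    exact ⟨l * k, by rw [map_mul, ← mul_sub]; exact TwoSidedIdeal.mul_mem_left _ _ _ hk⟩

/-- The retraction of `F[x] *_F K` onto `K` that sends `x` to `0`. -/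
noncomputable def augmentation : PolyFreeProd F K →ₐ[F] K := polyLift 0 (AlgHom.id F K)

@[simp] theorem augmentation_xElem : augmentation (xElem F K) = 0 := polyLift_xElem _ _

@[simp] theorem augmentation_ofK (k : K) : augmentation (ofK F K k) = k := polyLift_ofK _ _ _

theorem mem_xIdeal_iff {a : PolyFreeProd F K} : a ∈ xIdeal F K ↔ augmentation a = 0 := by
  have hle : ∀ a ∈ xIdeal F K, augmentation a = 0 := fun a ha => by
    have : xIdeal F K ≤ TwoSidedIdeal.ker (augmentation (F := F) (K := K)).toRingHom := by
      refine TwoSidedIdeal.span_le.2 ?_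
      rintro _ rfl
      rw [SetLike.mem_coe, TwoSidedIdeal.mem_ker]
      exact augmentation_xElem
    exact (TwoSidedIdeal.mem_ker _).1 (this ha)
  refine ⟨hle a, fun ha => ?_⟩
  obtain ⟨k, hk⟩ := exists_sub_ofK_mem_xIdeal a
  have := hle _ hk
  rw [map_sub, ha, augmentation_ofK, zero_sub, neg_eq_zero] at this
  rwa [this, map_zero, sub_zero] at hk

theorem isPrimeIdeal_xIdeal : (xIdeal F K).IsPrimeIdeal := by
  refine ⟨fun h => ?_, fun a b hab => ?_⟩
  · have : (1 : PolyFreeProd F K) ∈ xIdeal F K := h ▸ TwoSidedIdeal.mem_top _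
    rw [mem_xIdeal_iff, map_one] at this
    exact one_ne_zero this
  · have := hab 1
    simpa only [mem_xIdeal_iff, mul_one, map_mul, mul_eq_zero] using this

theorem isCoatom_xIdeal : IsCoatom (xIdeal F K) := by
  refine ⟨isPrimeIdeal_xIdeal.1, fun J hJ => ?_⟩
  obtain ⟨a, haJ, ha⟩ := SetLike.exists_of_lt hJ
  rw [mem_xIdeal_iff] at ha
  obtain ⟨hle, -⟩ := hJ
  have hmem : ofK F K (augmentation a) ∈ J := by
    have : a - ofK F K (augmentation a) ∈ xIdeal F K := by simp [mem_xIdeal_iff]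
    simpa using TwoSidedIdeal.sub_mem _ haJ (hle this)
  have := TwoSidedIdeal.mul_mem_left _ (ofK F K (augmentation a)⁻¹) _ hmem
  rwa [← map_mul, inv_mul_cancel₀ ha, map_one, TwoSidedIdeal.one_mem_iff] at this

theorem exists_quotient_xIdeal_algEquiv :
    ∃ e : (xIdeal F K).ringCon.Quotient ≃ₐ[F] K,
      ∀ k : K, e ((ofK F K k : PolyFreeProd F K) : (xIdeal F K).ringCon.Quotient) = k := by
  let φ : (xIdeal F K).ringCon.Quotient →ₐ[F] K :=
    RingCon.liftₐ _ augmentation fun a b hab => by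
      change augmentation a = augmentation b
      rwa [TwoSidedIdeal.rel_iff, mem_xIdeal_iff, map_sub, sub_eq_zero] at hab
  have hφ : ∀ a : PolyFreeProd F K, φ (a : (xIdeal F K).ringCon.Quotient) = augmentation a :=
    fun a => rfl
  refine ⟨AlgEquiv.ofBijective φ ⟨?_, fun k => ⟨(ofK F K k : PolyFreeProd F K), ?_⟩⟩,
    fun k => ?_⟩
  · intro a b
    induction a using Quotient.inductionOn with | _ a =>
    induction b using Quotient.inductionOn with | _ b =>
    intro hab
    refine Quotient.sound ?_
    change augmentation a = augmentation b at hab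
    change (xIdeal F K).ringCon a b
    rw [TwoSidedIdeal.rel_iff, mem_xIdeal_iff, map_sub, hab, sub_self]
  · rw [hφ, augmentation_ofK]
  · exact augmentation_ofK k

/-- The inclusion `x R x ⊆ R x K x R`: a word in `x` and `K` between two letters `x` is either an
element of `K` or contains a further letter `x`, and the first such letter gives a factor
`x k x`. -/
theorem xElem_mul_mul_xElem_mem (t : PolyFreeProd F K) :
    xElem F K * t * xElem F K ∈ xWxIdeal (⊤ : Submodule F K) := by
  have hmem : ∀ k, xElem F K * ofK F K k * xElem F K ∈ xWxIdeal (⊤ : Submodule F K) :=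
    fun k => TwoSidedIdeal.subset_span ⟨k, Submodule.mem_top, rfl⟩
  -- carrying along a factor `k` on the left of `t` makes the induction on `t` go through
  suffices h : ∀ k, xElem F K * ofK F K k * t * xElem F K ∈ xWxIdeal (⊤ : Submodule F K) by
    simpa using h 1
  induction t using PolyFreeProd.left_induction with
  | one => intro k; rw [mul_one]; exact hmem k
  | add a b ha hb =>
    intro k
    rw [mul_add, add_mul]
    exact TwoSidedIdeal.add_mem _ (ha k) (hb k)
  | x_mul a _ =>
    intro k
    have := TwoSidedIdeal.mul_mem_right _ _ (a * xElem F K) (hmem k)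
    simpa only [mul_assoc] using this
  | ofK_mul l a ha =>
    intro k
    have := ha (k * l)
    simpa only [map_mul, mul_assoc] using this

theorem xWxIdeal_top_eq_idealMul :
    xWxIdeal (⊤ : Submodule F K) = (xIdeal F K).idealMul (xIdeal F K) := by
  refine le_antisymm (TwoSidedIdeal.span_le.2 ?_) (TwoSidedIdeal.span_le.2 ?_)
  · rintro _ ⟨k, -, rfl⟩
    exact TwoSidedIdeal.subset_span ⟨_, TwoSidedIdeal.mul_mem_right _ _ _ xElem_mem_xIdeal, _,
      xElem_mem_xIdeal, rfl⟩
  · rintro _ ⟨a, ha, b, hb, rfl⟩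
    refine TwoSidedIdeal.mul_mem_of_mem_span_of_mem_span ?_ ha hb
    rintro _ rfl _ rfl r
    exact xElem_mul_mul_xElem_mem r

theorem primeRadical_idealMul_xIdeal :
    ((xIdeal F K).idealMul (xIdeal F K)).primeRadical = xIdeal F K := by
  refine le_antisymm (sInf_le ⟨isPrimeIdeal_xIdeal, TwoSidedIdeal.span_le.2 ?_⟩)
    (le_sInf ?_)
  · rintro _ ⟨a, ha, b, -, rfl⟩
    exact TwoSidedIdeal.mul_mem_right _ _ _ ha
  · rintro P ⟨hP, hle⟩
    refine TwoSidedIdeal.span_le.2 (Set.singleton_subset_iff.2 ?_)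
    refine or_self_iff.1 (hP.2 (xElem F K) (xElem F K) fun r => hle ?_)
    rw [← xWxIdeal_top_eq_idealMul]
    exact xElem_mul_mul_xElem_mem r

end Ideals

/-! ### The subspaces attached to a valuation -/

section Valued

variable {F : Type u} {K : Type v} {Γ : Type w} [Field F] [Field K] [Algebra F K]
  [AddCommGroup Γ] [LinearOrder Γ] [IsOrderedAddMonoid Γ]
  {ν : AddValuation K (WithTop Γ)} {hF : ∀ a : F, a ≠ 0 → ν (algebraMap F K a) = 0}

theorem mem_valuationSubspace {γ : Γ} {k : K} :
    k ∈ valuationSubspace ν hF γ ↔ ((-γ : Γ) : WithTop Γ) ≤ ν k := Iff.rfl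

theorem valuationSubspace_mono : Monotone (valuationSubspace ν hF) := fun _ _ h _ hk =>
  le_trans (WithTop.coe_le_coe.2 (neg_le_neg h)) hk

theorem exists_mem_valuationSubspace (k : K) : ∃ γ : Γ, k ∈ valuationSubspace ν hF γ := by
  by_cases h : ν k = ⊤
  · exact ⟨0, by rw [mem_valuationSubspace, h]; exact le_top⟩
  · obtain ⟨g, hg⟩ := WithTop.ne_top_iff_exists.1 h
    exact ⟨-g, by rw [mem_valuationSubspace, neg_neg, hg]⟩

theorem valuationSubspace_ne_top (hν : ∀ γ : Γ, ∃ k : K, ν k < (γ : WithTop Γ)) (γ : Γ) :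
    valuationSubspace ν hF γ ≠ ⊤ := by
  intro h
  obtain ⟨k, hk⟩ := hν (-γ)
  have hk' : k ∈ valuationSubspace ν hF γ := h ▸ Submodule.mem_top
  exact not_lt.2 hk' hk

/-- If `v N ⊆ W_γ` for some `v ≠ 0`, then `ν` is bounded below on `N`. -/
theorem exists_le_valuationSubspace_of_mul_mem {N : Submodule F K} {v : K} (hv : v ≠ 0) {γ : Γ}
    (h : ∀ b ∈ N, v * b ∈ valuationSubspace ν hF γ) : ∃ δ, N ≤ valuationSubspace ν hF δ := by
  obtain ⟨ε, hε⟩ := exists_mem_valuationSubspace (hF := hF) v⁻¹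
  refine ⟨γ + ε, fun b hb => ?_⟩
  have := add_le_add (mem_valuationSubspace.1 hε) (mem_valuationSubspace.1 (h b hb))
  rw [← AddValuation.map_mul, inv_mul_cancel_left₀ hv] at this
  rw [mem_valuationSubspace, neg_add_rev, WithTop.coe_add]
  exact this

theorem exists_fg_le_valuationSubspace {E : Submodule F K} (hE : E.FG) :
    ∃ δ, E ≤ valuationSubspace ν hF δ := by
  induction E, hE using Submodule.fg_induction with
  | singleton k =>
    obtain ⟨γ, hγ⟩ := exists_mem_valuationSubspace (hF := hF) k
    exact ⟨γ, (Submodule.span_singleton_le_iff_mem _ _).2 hγ⟩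
  | sup M N _ _ hM hN =>
    obtain ⟨γ, hγ⟩ := hM
    obtain ⟨δ, hδ⟩ := hN
    exact ⟨max γ δ, sup_le (hγ.trans (valuationSubspace_mono (le_max_left _ _)))
      (hδ.trans (valuationSubspace_mono (le_max_right _ _)))⟩

/-- For finite dimensional `V`, the subspace `{b | V b ⊆ K₀}` has finite codimension in `K`, and so
`ν` is not bounded below on it: otherwise `ν` would be bounded below on all of `K`. -/
theorem exists_mul_mem_and_notMem_valuationSubspace
    (hν : ∀ γ : Γ, ∃ k : K, ν k < (γ : WithTop Γ)) (γ : Γ) {K₀ : Submodule F K}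
    (hK₀ : IsCompl (1 : Submodule F K) K₀) {V : Submodule F K} (hV : V ≠ ⊥)
    [FiniteDimensional F V] :
    ∃ b : K, (∀ v ∈ V, v * b ∈ K₀) ∧ ∃ v ∈ V, v * b ∉ valuationSubspace ν hF γ := by
  by_contra! hcon
  have : FiniteDimensional F (1 : Submodule F K) := by
    rw [Submodule.one_eq_span]; infer_instance
  have : FiniteDimensional F (K ⧸ K₀) :=
    (Submodule.quotientEquivOfIsCompl K₀ 1 hK₀.symm).symm.finiteDimensional
  let f : K →ₗ[F] V →ₗ[F] K ⧸ K₀ :=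
    ((LinearMap.mul F K).compl₂ V.subtype).compr₂ K₀.mkQ
  have hf : ∀ b, b ∈ LinearMap.ker f ↔ ∀ v ∈ V, v * b ∈ K₀ := fun b => by
    rw [LinearMap.mem_ker, LinearMap.ext_iff, Subtype.forall]
    refine forall₂_congr fun v hv => ?_
    rw [mul_comm, ← Submodule.Quotient.mk_eq_zero]
    rfl
  obtain ⟨E, hE⟩ := Submodule.exists_isCompl (LinearMap.ker f)
  have hfg : E.FG := by
    have : FiniteDimensional F E :=
      Module.Finite.equiv ((Submodule.quotientEquivOfIsCompl _ E hE).symm.trans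
        f.quotKerEquivRange).symm
    exact Submodule.fg_iff_finiteDimensional _ |>.2 this
  obtain ⟨v, hvV, hv⟩ := Submodule.exists_mem_ne_zero_of_ne_bot hV
  obtain ⟨δ, hδ⟩ := exists_le_valuationSubspace_of_mul_mem (hF := hF) (N := LinearMap.ker f) hv
    (γ := γ) fun b hb => hcon b ((hf b).1 hb) v hvV
  obtain ⟨ε, hε⟩ := exists_fg_le_valuationSubspace (hF := hF) hfg
  refine valuationSubspace_ne_top (hF := hF) hν (max δ ε) (top_unique ?_)
  rw [← hE.sup_eq_top]
  exact sup_le (hδ.trans (valuationSubspace_mono (le_max_left _ _)))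
    (hε.trans (valuationSubspace_mono (le_max_right _ _)))

theorem isRestrictedSubspace_valuationSubspace (hν : ∀ γ : Γ, ∃ k : K, ν k < (γ : WithTop Γ))
    {γ : Γ} (hγ : 0 ≤ γ) {K₀ : Submodule F K} (hK₀ : IsCompl (1 : Submodule F K) K₀) :
    IsRestrictedSubspace K₀ (valuationSubspace ν hF γ) where
  one_le := by
    rw [Submodule.one_le, mem_valuationSubspace, AddValuation.map_one]
    exact WithTop.coe_le_coe.2 (neg_nonpos.2 hγ)
  right _ hV _ := exists_mul_mem_and_notMem_valuationSubspace hν γ hK₀ hV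
  left V hV _ := by
    simpa only [mul_comm] using exists_mul_mem_and_notMem_valuationSubspace (hF := hF) hν γ hK₀ hV

end Valued

theorem mainTheorem6 {F : Type u} {K : Type v} {Γ : Type w} [Field F] [Field K] [Algebra F K]
    [AddCommGroup Γ] [LinearOrder Γ] [IsOrderedAddMonoid Γ]
    (ν : AddValuation K (WithTop Γ))
    (hF : ∀ a : F, a ≠ 0 → ν (algebraMap F K a) = 0)
    (hν : ∀ γ : Γ, ∃ k : K, ν k < (γ : WithTop Γ)) :
    -- each `W_γ`, `γ ≥ 0`, is restricted, for every decomposition `K = F ⊕ K₀`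
    (∀ γ : Γ, 0 ≤ γ → ∀ K₀ : Submodule F K, IsCompl (1 : Submodule F K) K₀ →
      IsRestrictedSubspace K₀ (valuationSubspace ν hF γ)) ∧
    -- the ideals `P_γ = R x W_γ x R` are prime and form a chain
    (∀ γ : Γ, 0 ≤ γ → (xWxIdeal (valuationSubspace ν hF γ)).IsPrimeIdeal) ∧
    (∀ γ δ : Γ, γ ≤ δ →
      xWxIdeal (valuationSubspace ν hF γ) ≤ xWxIdeal (valuationSubspace ν hF δ)) ∧
    -- the union of the chain, over any cofinal set of indices, is `R x K x R = (R x R)²`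
    (∀ S : Set Γ, S ⊆ Set.Ici 0 → IsCofinal S →
      (⋃ γ ∈ S, (valuationSubspace ν hF γ : Set K)) = Set.univ ∧
      (⋃ γ ∈ S, (xWxIdeal (valuationSubspace ν hF γ) : Set (PolyFreeProd F K))) =
        (xWxIdeal (⊤ : Submodule F K) : Set (PolyFreeProd F K))) ∧
    xWxIdeal (⊤ : Submodule F K) = (xIdeal F K).idealMul (xIdeal F K) ∧
    -- which is not semiprime, while its radical is the maximal ideal `R x R`
    ¬ ((xIdeal F K).idealMul (xIdeal F K)).IsSemiprimeIdeal ∧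
    ((xIdeal F K).idealMul (xIdeal F K)).primeRadical = xIdeal F K ∧
    IsCoatom (xIdeal F K) ∧
    -- and `R / R x R ≅ K` as `K`-rings
    (∃ e : (xIdeal F K).ringCon.Quotient ≃ₐ[F] K,
      ∀ k : K, e ((ofK F K k : PolyFreeProd F K) : (xIdeal F K).ringCon.Quotient) = k) := by
  refine ⟨fun γ hγ K₀ hK₀ => isRestrictedSubspace_valuationSubspace hν hγ hK₀,
    fun γ _ => isPrimeIdeal_xWxIdeal (valuationSubspace_ne_top hν γ),
    fun γ δ h => xWxIdeal_mono (valuationSubspace_mono h), fun S _ hcof => ?_,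
    xWxIdeal_top_eq_idealMul, fun hsemi => ?_, primeRadical_idealMul_xIdeal, isCoatom_xIdeal,
    exists_quotient_xIdeal_algEquiv⟩
  · have cover : ∀ k : K, ∃ γ : S, k ∈ valuationSubspace ν hF γ := fun k => by
      obtain ⟨γ, hγ⟩ := exists_mem_valuationSubspace (hF := hF) k
      obtain ⟨δ, hδ, hle⟩ := hcof γ
      exact ⟨⟨δ, hδ⟩, valuationSubspace_mono hle hγ⟩
    have : Nonempty S := (cover 0).nonempty
    have hdir : Directed (· ≤ ·) fun γ : S => valuationSubspace ν hF γ :=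
      Monotone.directed_le fun _ _ h => valuationSubspace_mono h
    constructor
    · ext k
      simpa using cover k
    · ext z
      simp only [Set.mem_iUnion, SetLike.mem_coe, exists_prop]
      refine ⟨fun ⟨γ, _, hz⟩ => xWxIdeal_mono le_top hz, fun hz => ?_⟩
      obtain ⟨⟨γ, hγ⟩, h⟩ := exists_mem_xWxIdeal_of_mem_top hdir cover hz
      exact ⟨γ, hγ, h⟩
  · rw [← xWxIdeal_top_eq_idealMul] at hsemi
    have hdir : Directed (· ≤ ·) (valuationSubspace ν hF) := valuationSubspace_mono.directed_le
    obtain ⟨γ, hγ⟩ := exists_mem_xWxIdeal_of_mem_top hdir exists_mem_valuationSubspace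
      (hsemi (xElem F K) xElem_mul_mul_xElem_mem)
    exact xElem_notMem_xWxIdeal (valuationSubspace_ne_top hν γ) hγ
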